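/- An edge colouring of a finite graph $F$ is any assignment of colours to the edges of $F$; it is called $k$-bounded if every colour is used on at most $k$ edges of $F$ in total. A rainbow copy of $G$ in an edge-coloured $F$ is a copy of $G$ in $F$ (the image of an injective map $V(G)\to V(F)$ that maps edges to edges) in which all edges receive distinct colours. (1) Let $G$ be a graph on $n$ vertices with maximum degree $\Delta>0$, and let $k$ be a real number with $k\le n/(51\Delta^2)$. Then every $k$-bounded edge colouring of the complete graph $K_n$ contains a rainbow copy of $G$. (2) Consequently (the conjecture of Frieze and Krivelevich on spanning trees): for every integer $D>0$ there is a constant $c=c(D)>0$ such that for every $n$, every tree $T$ on $n$ vertices with maximum degree at most $D$, and every real $k\le cn$, every $k$-bounded edge colouring of $K_n$ contains a rainbow copy of $T$. -/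

import Mathlib

/-- An edge colouring `χ` of a graph `F` is `k`-bounded if every colour is used on at most `k`
edges of `F` in total. -/
def IsBoundedColouring {W C : Type*} {F : SimpleGraph W} (χ : F.EdgeLabeling C) (k : ℝ) : Prop :=
  ∀ c : C, {e : F.edgeSet | χ e = c}.Finite ∧ ({e : F.edgeSet | χ e = c}.ncard : ℝ) ≤ k

/-- An edge colouring is rainbow if all edges receive distinct colours. -/
def IsRainbow {W C : Type*} {F : SimpleGraph W} (χ : F.EdgeLabeling C) : Prop :=
  ∀ e f : F.edgeSet, χ e = χ f → e = f

/-- An edge colouring `χ` of `F` contains a rainbow copy of `G`: there is an injective homomorphism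
`G → F` whose image is rainbow coloured by `χ`. -/
def HasRainbowCopy {V W C : Type*} {F : SimpleGraph W} (χ : F.EdgeLabeling C)
    (G : SimpleGraph V) : Prop :=
  ∃ φ : SimpleGraph.Copy G F, IsRainbow (χ.pullback φ.toHom)

/-!
A uniformly random bijection from the vertices of `G` to those of the complete graph is a rainbow
copy of `G` with positive probability, by the lopsided local lemma. The bijection fails to be
rainbow exactly if it extends some bad partial map: one that sends two disjoint edges of `G` (four
vertices), or two adjacent ones (three vertices), to edges of the same colour.

Two facts make the local lemma applicable. First, random bijections are negatively dependent:
conditioned on avoiding partial maps disjoint from `σ` in domain and range, the probability of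
extending a partial map `σ` on `r` vertices is at most `1 / (n (n - 1) ⋯ (n - r + 1))`
(`descFactorial_mul_card_avoiding_inter_extending_le`). So only partial maps sharing a vertex with
`σ` in domain or range count as its neighbours, and these are covered by the `2 r` families of bad
partial maps through a vertex. Second, such a family is small: it has at most about `Δ² n³ k`
members on four vertices and `3 / 2 · Δ² n² k` members on three.

Give a bad partial map the weight `16 / 5` (four vertices) or `12 / 5` (three vertices) times the
probability bound above. Since `51 Δ² k ≤ n`, the total weight at any vertex is at most
`(16 / 5 + 3 / 2 · 12 / 5) / 51 = 2 / 15`, and the local lemma (`avoiding_nonempty`) asks for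
`exp (8 · 2 / 15) ≤ 16 / 5` and `exp (6 · 2 / 15) ≤ 12 / 5`, which hold. For trees it suffices to
take `c = 1 / (51 D²)`.
-/

namespace RainbowCopy

open Finset

/-! ### The lopsided local lemma -/

section LocalLemma

variable {Ω ι : Type*} [Fintype Ω] [DecidableEq Ω]

/-- The outcomes at which none of the events `A i` with `i ∈ S` happens. -/
def avoiding (A : ι → Finset Ω) (S : Finset ι) : Finset Ω :=
  {ω | ∀ i ∈ S, ω ∉ A i}

theorem mem_avoiding {A : ι → Finset Ω} {S : Finset ι} {ω : Ω} :
    ω ∈ avoiding A S ↔ ∀ i ∈ S, ω ∉ A i := by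
  simp [avoiding]

theorem avoiding_anti (A : ι → Finset Ω) {S T : Finset ι} (h : S ⊆ T) :
    avoiding A T ⊆ avoiding A S := fun _ hω ↦
  mem_avoiding.2 fun i hi ↦ mem_avoiding.1 hω i (h hi)

variable [DecidableEq ι]

theorem card_avoiding_insert (A : ι → Finset Ω) (S : Finset ι) (i : ι) :
    #(avoiding A (insert i S)) + #(avoiding A S ∩ A i) = #(avoiding A S) := by
  have : avoiding A (insert i S) = avoiding A S \ A i := by
    ext ω
    simp only [mem_avoiding, mem_insert, forall_eq_or_imp, mem_sdiff]
    tauto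
  rw [this, card_sdiff_add_card_inter]

/-- Suppose that an event `A i` with `i ∈ T` has conditional probability at most `μ i / (1 + μ i)`
whenever the events indexed by a proper subset of `S ∪ T` are avoided. Then avoiding the events in
`T` one after the other costs a factor of at most `∏ i ∈ T, (1 + μ i)`. -/
theorem card_avoiding_le_prod (A : ι → Finset Ω) (μ : ι → ℝ) (hμ : ∀ i, 0 ≤ μ i)
    (S T : Finset ι) (hST : Disjoint S T)
    (h : ∀ R ⊂ S ∪ T, ∀ i ∈ T,
      (1 + μ i) * #(avoiding A R ∩ A i) ≤ μ i * #(avoiding A R)) :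
    (#(avoiding A S) : ℝ) ≤ (∏ i ∈ T, (1 + μ i)) * #(avoiding A (S ∪ T)) := by
  induction T using Finset.induction_on with
  | empty => simp
  | insert a T ha ih =>
    rw [disjoint_insert_right] at hST
    have hlt : S ∪ T ⊂ S ∪ insert a T := by
      rw [union_insert]
      exact ssubset_insert (by simp [hST.1, ha])
    have h1 := ih hST.2 fun R hR i hi ↦ h R (hR.trans hlt) i (mem_insert_of_mem hi)
    have h2 := h _ hlt a (mem_insert_self _ _)
    have h3 : (#(avoiding A (insert a (S ∪ T))) : ℝ) + #(avoiding A (S ∪ T) ∩ A a)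
        = #(avoiding A (S ∪ T)) := mod_cast card_avoiding_insert A (S ∪ T) a
    rw [prod_insert ha, union_insert]
    refine h1.trans ?_
    have hp : 0 ≤ ∏ i ∈ T, (1 + μ i) := prod_nonneg fun i _ ↦ by linarith [hμ i]
    calc (∏ i ∈ T, (1 + μ i)) * (#(avoiding A (S ∪ T)) : ℝ)
        ≤ (∏ i ∈ T, (1 + μ i)) * ((1 + μ a) * #(avoiding A (insert a (S ∪ T)))) := by
          rw [eq_sub_of_add_eq h3]
          gcongr
          linarith
      _ = _ := by ring

/-- The lopsided local lemma on a finite uniform probability space, with denominators cleared. The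
set `Γ i` contains `i` and the events on which `A i` may depend unfavourably. -/
theorem avoiding_nonempty [Nonempty Ω] (A : ι → Finset Ω) (μ : ι → ℝ) (hμ : ∀ i, 0 ≤ μ i)
    (B : Finset ι) (Γ : ι → Finset ι) (hΓ : ∀ i ∈ B, i ∈ Γ i)
    (h : ∀ i ∈ B, ∀ S ⊆ B, Disjoint S (Γ i) →
      #(avoiding A S ∩ A i) * ∏ j ∈ Γ i, (1 + μ j) ≤ μ i * #(avoiding A S)) :
    (avoiding A B).Nonempty := by
  have key : ∀ S : Finset ι, S ⊆ B → ∀ i ∈ B,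
      (1 + μ i) * #(avoiding A S ∩ A i) ≤ μ i * #(avoiding A S) := by
    intro S
    induction S using Finset.strongInduction with
    | H S ih =>
    intro hS i hi
    by_cases hiS : i ∈ S
    · have : avoiding A S ∩ A i = ∅ := by
        ext ω
        simp only [mem_inter, notMem_empty, iff_false, not_and]
        exact fun hω ↦ mem_avoiding.1 hω i hiS
      rw [this]
      have := hμ i
      simp only [card_empty, Nat.cast_zero, mul_zero]
      positivity
    -- Split `S` into the events far from `A i` and the neighbours of `A i`.
    have hsplit : S \ Γ i ∪ S ∩ Γ i = S := sdiff_union_inter S (Γ i)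
    have h1 := card_avoiding_le_prod A μ hμ (S \ Γ i) (S ∩ Γ i) (disjoint_sdiff_inter S (Γ i)) <| by
      rw [hsplit]
      exact fun R hR j hj ↦ ih R hR (hR.subset.trans hS) j (hS (mem_inter.1 hj).1)
    rw [hsplit] at h1
    have h2 := h i hi (S \ Γ i) (sdiff_subset.trans hS) sdiff_disjoint
    have h3 : (#(avoiding A S ∩ A i) : ℝ) ≤ #(avoiding A (S \ Γ i) ∩ A i) := by
      exact_mod_cast card_le_card (inter_subset_inter_right (avoiding_anti A sdiff_subset))
    have hpos : ∀ T : Finset ι, 0 < ∏ j ∈ T, (1 + μ j) :=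
      fun T ↦ prod_pos fun j _ ↦ by linarith [hμ j]
    have h4 : (1 + μ i) * ∏ j ∈ S ∩ Γ i, (1 + μ j) ≤ ∏ j ∈ Γ i, (1 + μ j) := by
      rw [← prod_insert (s := S ∩ Γ i) (f := fun j ↦ 1 + μ j) (by simp [hiS])]
      exact Finset.prod_le_prod_of_subset_of_one_le
        (insert_subset (hΓ i hi) inter_subset_right)
        (fun j _ ↦ by linarith [hμ j]) fun j _ _ ↦ by linarith [hμ j]
    have h5 : (∏ j ∈ S ∩ Γ i, (1 + μ j)) * ((1 + μ i) * #(avoiding A S ∩ A i)) ≤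
        (∏ j ∈ S ∩ Γ i, (1 + μ j)) * (μ i * #(avoiding A S)) :=
      calc _ = #(avoiding A S ∩ A i) * ((1 + μ i) * ∏ j ∈ S ∩ Γ i, (1 + μ j)) := by ring
        _ ≤ #(avoiding A (S \ Γ i) ∩ A i) * ∏ j ∈ Γ i, (1 + μ j) := by
          gcongr
          exact (mul_pos (by linarith [hμ i]) (hpos _)).le
        _ ≤ μ i * #(avoiding A (S \ Γ i)) := h2
        _ ≤ μ i * ((∏ j ∈ S ∩ Γ i, (1 + μ j)) * #(avoiding A S)) := by
          gcongr
          exact hμ i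
        _ = _ := by ring
    exact le_of_mul_le_mul_left h5 (hpos _)
  have h1 := card_avoiding_le_prod A μ hμ ∅ B (disjoint_empty_left _) <| by
    rw [empty_union]
    exact fun R hR i hi ↦ key R hR.subset i hi
  rw [empty_union] at h1
  have h0 : (0 : ℝ) < #(avoiding A ∅) := by
    have : avoiding A ∅ = univ := by ext; simp [mem_avoiding]
    rw [this]
    exact_mod_cast card_pos.2 univ_nonempty
  rw [← card_pos]
  by_contra hB
  rw [Nat.eq_zero_of_not_pos hB, Nat.cast_zero, mul_zero] at h1
  linarith

end LocalLemma

/-! ### Negative dependence for random bijections -/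

section Bijections

variable {V W ι : Type*} [DecidableEq V] [DecidableEq W] [Fintype ι]

/-- The graph of the partial map `p i ↦ q i` from `V` to `W`. -/
def pairing (p : ι → V) (q : ι → W) : Finset (V × W) :=
  univ.image fun i ↦ (p i, q i)

theorem mem_pairing {p : ι → V} {q : ι → W} {x : V × W} :
    x ∈ pairing p q ↔ ∃ i, (p i, q i) = x := by
  simp [pairing]

theorem card_pairing {p : ι → V} (hp : Function.Injective p) (q : ι → W) :
    #(pairing p q) = Fintype.card ι := by
  rw [pairing, card_image_of_injective _ fun i j h ↦ hp (Prod.ext_iff.1 h).1, card_univ]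

/-- Precomposing with a permutation of the indices does not change the partial map. -/
theorem pairing_comp_perm (p : ι → V) (q : ι → W) (s : Equiv.Perm ι) :
    pairing (p ∘ s) (q ∘ s) = pairing p q := by
  ext x
  simp only [mem_pairing, Function.comp_apply]
  exact s.exists_congr_left.trans (by simp)

/-- The partial maps `p ↦ q` with `p ∈ P` and `q ∈ Q`. -/
def pairings (P : Finset (ι → V)) (Q : Finset (ι → W)) : Finset (Finset (V × W)) :=
  image₂ pairing P Q

theorem card_pairings_le (P : Finset (ι → V)) (Q : Finset (ι → W)) :
    #(pairings P Q) ≤ #P * #Q := card_image₂_le _ _ _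

/-- If `P` and `Q` are stable under a permutation of the indices, every partial map arises
at least twice. -/
theorem two_mul_card_pairings_le {P : Finset (ι → V)} {Q : Finset (ι → W)}
    (s : Equiv.Perm ι) (hs : s ≠ 1) (hP : ∀ p ∈ P, Function.Injective p ∧ p ∘ s ∈ P)
    (hQ : ∀ q ∈ Q, q ∘ s ∈ Q) :
    2 * #(pairings P Q) ≤ #P * #Q := by
  rw [← card_product]
  refine mul_card_image_le_card_of_maps_to (f := fun x : (ι → V) × (ι → W) ↦ pairing x.1 x.2)
    (fun x hx ↦ ?_) 2 fun τ hτ ↦ ?_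
  · rw [mem_product] at hx
    exact mem_image₂_of_mem hx.1 hx.2
  · obtain ⟨p, hp, q, hq, rfl⟩ := mem_image₂.1 hτ
    refine one_lt_card.2 ⟨(p, q), by simp [hp, hq], (p ∘ s, q ∘ s), ?_, fun h ↦ hs ?_⟩
    · simp [(hP p hp).2, hQ q hq, pairing_comp_perm]
    · ext i
      exact ((hP p hp).1 (congrFun (Prod.ext_iff.1 h).1 i)).symm

/-- If `P` and `Q` are stable under a permutation `s` of the indices, a partial map `p ↦ q` defined
at `p (s j)` may be rewritten so that this vertex carries the index `j`. -/
theorem pairing_mem_pairings_of_fst {P : Finset (ι → V)} {Q : Finset (ι → W)} {p : ι → V}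
    {q : ι → W} (hp : p ∈ P) (hq : q ∈ Q) (s : Equiv.Perm ι) (j : ι)
    (hP : ∀ p ∈ P, p ∘ s ∈ P) (hQ : ∀ q ∈ Q, q ∘ s ∈ Q) :
    pairing p q ∈ pairings {r ∈ P | r j = p (s j)} Q := by
  rw [← pairing_comp_perm p q s]
  exact mem_image₂_of_mem (mem_filter.2 ⟨hP p hp, rfl⟩) (hQ q hq)

theorem pairing_mem_pairings_of_snd {P : Finset (ι → V)} {Q : Finset (ι → W)} {p : ι → V}
    {q : ι → W} (hp : p ∈ P) (hq : q ∈ Q) (s : Equiv.Perm ι) (j : ι)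
    (hP : ∀ p ∈ P, p ∘ s ∈ P) (hQ : ∀ q ∈ Q, q ∘ s ∈ Q) :
    pairing p q ∈ pairings P {r ∈ Q | r j = q (s j)} := by
  rw [← pairing_comp_perm p q s]
  exact mem_image₂_of_mem (hP p hp) (mem_filter.2 ⟨hQ q hq, rfl⟩)

variable [Fintype V] [Fintype W]

/-- The bijections `V ≃ W` that extend the partial map with graph `τ`. -/
def extending (τ : Finset (V × W)) : Finset (V ≃ W) :=
  {φ | ∀ x ∈ τ, φ x.1 = x.2}

theorem mem_extending {τ : Finset (V × W)} {φ : V ≃ W} :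
    φ ∈ extending τ ↔ ∀ x ∈ τ, φ x.1 = x.2 := by
  simp [extending]

theorem mem_extending_pairing {p : ι → V} {q : ι → W} {φ : V ≃ W} :
    φ ∈ extending (pairing p q) ↔ ∀ i, φ (p i) = q i := by
  simp [mem_extending, pairing]

/-- Among the bijections avoiding partial maps that are disjoint from `p ↦ q` in domain and
range, those extending `p ↦ q` are no more numerous than those extending any other `p ↦ b`:
composing with a permutation of `W` that takes `q` to `b` and moves nothing outside their ranges
creates none of the avoided partial maps. -/
theorem card_avoiding_inter_extending_le (p : ι → V) {q b : ι → W}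
    (hq : Function.Injective q) (hb : Function.Injective b)
    (S : Finset (Finset (V × W)))
    (hS : ∀ τ ∈ S, ∀ x ∈ τ, (∀ i, x.1 ≠ p i) ∧ ∀ i, x.2 ≠ q i) :
    #(avoiding extending S ∩ extending (pairing p q)) ≤
      #(avoiding extending S ∩ extending (pairing p b)) := by
  let E := {w : W // (∀ i, w ≠ q i) ∧ ∀ i, w ≠ b i}
  obtain ⟨π, hπ⟩ : ∃ π : Equiv.Perm W, ∀ i, π (Sum.elim q (Subtype.val : E → W) i) =
      Sum.elim b (Subtype.val : E → W) i := by
    apply Equiv.Perm.exists_extending_pair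
    · exact hq.sumElim Subtype.val_injective fun i w h ↦ w.2.1 i h.symm
    · exact hb.sumElim Subtype.val_injective fun i w h ↦ w.2.2 i h.symm
  have hπq : ∀ i, π (q i) = b i := fun i ↦ hπ (Sum.inl i)
  have hπE : ∀ w, (∀ i, w ≠ q i) → (∀ i, w ≠ b i) → π w = w :=
    fun w h1 h2 ↦ hπ (Sum.inr ⟨w, h1, h2⟩)
  refine card_le_card_of_injOn (fun φ ↦ φ.trans π) ?_ ?_
  · intro φ hφ
    simp only [coe_inter, Set.mem_inter_iff, mem_coe, mem_avoiding, mem_extending_pairing] at hφ ⊢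
    obtain ⟨h1, h2⟩ := hφ
    have h3 : ∀ i, (φ.trans π) (p i) = b i := fun i ↦ by simp [h2, hπq]
    refine ⟨fun τ hτ hφτ ↦ h1 τ hτ ?_, h3⟩
    rw [mem_extending] at hφτ ⊢
    intro x hx
    obtain ⟨hx1, hx2⟩ := hS τ hτ x hx
    have h4 := hφτ x hx
    have h5 : π x.2 = x.2 := by
      refine hπE _ hx2 fun i hi ↦ hx1 i ?_
      rw [← h3 i] at hi
      exact (φ.trans π).injective (h4.trans hi)
    exact π.injective (h4.trans h5.symm)
  · intro φ _ ψ _ h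
    ext v
    exact π.injective (DFunLike.congr_fun h v)

/-- Lopsidedness: conditioned on avoiding partial maps disjoint from `p ↦ q` in domain and range, a
uniformly random bijection extends `p ↦ q` with probability at most
`1 / (n (n - 1) ⋯ (n - |ι| + 1))`. -/
theorem descFactorial_mul_card_avoiding_inter_extending_le [DecidableEq ι] (p : ι → V) {q : ι → W}
    (hp : Function.Injective p) (hq : Function.Injective q) (S : Finset (Finset (V × W)))
    (hS : ∀ τ ∈ S, ∀ x ∈ τ, (∀ i, x.1 ≠ p i) ∧ ∀ i, x.2 ≠ q i) :
    (Fintype.card W).descFactorial (Fintype.card ι) *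
      #(avoiding extending S ∩ extending (pairing p q)) ≤ #(avoiding extending S) := by
  rw [← Fintype.card_embedding_eq, ← card_univ, ← smul_eq_mul, ← sum_const]
  have h1 : #(avoiding extending S) = ∑ b : ι ↪ W,
      #{φ ∈ avoiding extending S | (⟨fun i ↦ φ (p i), φ.injective.comp hp⟩ : ι ↪ W) = b} :=
    card_eq_sum_card_fiberwise fun _ _ ↦ by simp
  rw [h1]
  refine sum_le_sum fun b _ ↦
    (card_avoiding_inter_extending_le p hq b.injective S hS).trans (card_le_card fun φ hφ ↦ ?_)
  rw [mem_inter, mem_extending_pairing] at hφ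
  rw [mem_filter]
  exact ⟨hφ.1, DFunLike.ext _ _ hφ.2⟩

end Bijections

/-! ### Counting pairs of edges -/

section Counting

theorem card_le_mul_of_coord {ι α : Type*} [DecidableEq α] {S : Finset (ι → α)} (i : ι)
    {t : Finset α} {m k : ℕ} (ht : ∀ p ∈ S, p i ∈ t) (hk : #t ≤ k)
    (h : ∀ a ∈ t, #{p ∈ S | p i = a} ≤ m) : #S ≤ m * k :=
  (card_le_mul_card_image_of_maps_to (f := fun p ↦ p i) ht m h).trans (Nat.mul_le_mul_left m hk)

variable {V : Type*} [Fintype V] [DecidableEq V]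

/-- The ordered pairs of disjoint edges `p 0 p 1` and `p 2 p 3`, each with an orientation. -/
def matchings (G : SimpleGraph V) [DecidableRel G.Adj] : Finset (Fin 4 → V) :=
  {p | Function.Injective p ∧ G.Adj (p 0) (p 1) ∧ G.Adj (p 2) (p 3)}

/-- The ordered pairs of edges `p 0 p 1` and `p 1 p 2` that share the vertex `p 1` only. -/
def cherries (G : SimpleGraph V) [DecidableRel G.Adj] : Finset (Fin 3 → V) :=
  {p | Function.Injective p ∧ G.Adj (p 0) (p 1) ∧ G.Adj (p 1) (p 2)}

section Graph

variable {G : SimpleGraph V} [DecidableRel G.Adj] {Δ : ℕ}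

theorem mem_matchings {p : Fin 4 → V} :
    p ∈ matchings G ↔ Function.Injective p ∧ G.Adj (p 0) (p 1) ∧ G.Adj (p 2) (p 3) := by
  simp [matchings]

theorem mem_cherries {p : Fin 3 → V} :
    p ∈ cherries G ↔ Function.Injective p ∧ G.Adj (p 0) (p 1) ∧ G.Adj (p 1) (p 2) := by
  simp [cherries]

theorem card_matchings_start_le (hΔ : ∀ v, G.degree v ≤ Δ) (u : V) :
    #{p ∈ matchings G | p 0 = u} ≤ 1 * Δ * Fintype.card V * Δ := by
  refine card_le_mul_of_coord 1 (t := G.neighborFinset u) ?_ (hΔ u) fun v _ ↦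
    card_le_mul_of_coord 2 (t := univ) ?_ card_univ.le fun w _ ↦
    card_le_mul_of_coord 3 (t := G.neighborFinset w) ?_ (hΔ w) fun x _ ↦ card_le_one.2 ?_
  · simp only [mem_filter, mem_matchings, SimpleGraph.mem_neighborFinset]
    rintro p ⟨⟨-, h, -⟩, rfl⟩
    exact h
  · simp
  · simp only [mem_filter, mem_matchings, SimpleGraph.mem_neighborFinset]
    rintro p ⟨⟨⟨⟨-, -, h⟩, -⟩, -⟩, rfl⟩
    exact h
  · simp only [mem_filter]
    rintro p ⟨⟨⟨⟨-, h0⟩, h1⟩, h2⟩, h3⟩ q ⟨⟨⟨⟨-, k0⟩, k1⟩, k2⟩, k3⟩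
    ext i
    fin_cases i <;> simp_all

theorem card_matchings_le (hΔ : ∀ v, G.degree v ≤ Δ) :
    #(matchings G) ≤ 1 * Δ * Fintype.card V * Δ * Fintype.card V :=
  card_le_mul_of_coord 0 (t := univ) (by simp) card_univ.le
    fun u _ ↦ card_matchings_start_le hΔ u

theorem card_cherries_start_le (hΔ : ∀ v, G.degree v ≤ Δ) (u : V) :
    #{p ∈ cherries G | p 0 = u} ≤ 1 * Δ * Δ := by
  refine card_le_mul_of_coord 1 (t := G.neighborFinset u) ?_ (hΔ u) fun v _ ↦
    card_le_mul_of_coord 2 (t := G.neighborFinset v) ?_ (hΔ v) fun w _ ↦ card_le_one.2 ?_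
  · simp only [mem_filter, mem_cherries, SimpleGraph.mem_neighborFinset]
    rintro p ⟨⟨-, h, -⟩, rfl⟩
    exact h
  · simp only [mem_filter, mem_cherries, SimpleGraph.mem_neighborFinset]
    rintro p ⟨⟨⟨-, -, h⟩, -⟩, rfl⟩
    exact h
  · simp only [mem_filter]
    rintro p ⟨⟨⟨-, h0⟩, h1⟩, h2⟩ q ⟨⟨⟨-, k0⟩, k1⟩, k2⟩
    ext i
    fin_cases i <;> simp_all

theorem card_cherries_centre_le (hΔ : ∀ v, G.degree v ≤ Δ) (u : V) :
    #{p ∈ cherries G | p 1 = u} ≤ 1 * Δ * Δ := by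
  refine card_le_mul_of_coord 0 (t := G.neighborFinset u) ?_ (hΔ u) fun v _ ↦
    card_le_mul_of_coord 2 (t := G.neighborFinset u) ?_ (hΔ u) fun w _ ↦ card_le_one.2 ?_
  · simp only [mem_filter, mem_cherries, SimpleGraph.mem_neighborFinset]
    rintro p ⟨⟨-, h, -⟩, rfl⟩
    exact h.symm
  · simp only [mem_filter, mem_cherries, SimpleGraph.mem_neighborFinset]
    rintro p ⟨⟨⟨-, -, h⟩, rfl⟩, -⟩
    exact h
  · simp only [mem_filter]
    rintro p ⟨⟨⟨-, h0⟩, h1⟩, h2⟩ q ⟨⟨⟨-, k0⟩, k1⟩, k2⟩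
    ext i
    fin_cases i <;> simp_all

theorem card_cherries_le (hΔ : ∀ v, G.degree v ≤ Δ) :
    #(cherries G) ≤ 1 * Δ * Δ * Fintype.card V :=
  card_le_mul_of_coord 0 (t := univ) (by simp) card_univ.le
    fun u _ ↦ card_cherries_start_le hΔ u

end Graph

variable {C : Type*} [DecidableEq C]

/-- The ordered pairs of oriented disjoint edges of the complete graph that have the same
colour. -/
def monoMatchings (χ : Sym2 V → C) : Finset (Fin 4 → V) :=
  {q | Function.Injective q ∧ χ s(q 0, q 1) = χ s(q 2, q 3)}

/-- The ordered pairs of edges `q 0 q 1` and `q 1 q 2` of the complete graph that share the vertex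
`q 1` only and have the same colour. -/
def monoCherries (χ : Sym2 V → C) : Finset (Fin 3 → V) :=
  {q | Function.Injective q ∧ χ s(q 0, q 1) = χ s(q 1, q 2)}

/-- The edges of the complete graph, other than `e`, that have the colour of `e`. -/
def sameColour (χ : Sym2 V → C) (e : Sym2 V) : Finset (Sym2 V) :=
  {f | ¬f.IsDiag ∧ f ≠ e ∧ χ f = χ e}

section Colouring

variable {χ : Sym2 V → C} {m : ℕ}

theorem mem_monoMatchings {q : Fin 4 → V} :
    q ∈ monoMatchings χ ↔ Function.Injective q ∧ χ s(q 0, q 1) = χ s(q 2, q 3) := by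
  simp [monoMatchings]

theorem mem_monoCherries {q : Fin 3 → V} :
    q ∈ monoCherries χ ↔ Function.Injective q ∧ χ s(q 0, q 1) = χ s(q 1, q 2) := by
  simp [monoCherries]

theorem mem_sameColour {e f : Sym2 V} :
    f ∈ sameColour χ e ↔ ¬f.IsDiag ∧ f ≠ e ∧ χ f = χ e := by
  simp [sameColour]

theorem card_monoMatchings_start_le
    (hm : ∀ e : Sym2 V, ¬e.IsDiag → #(sameColour χ e) ≤ m)
    (v : V) :
    #{q ∈ monoMatchings χ | q 0 = v} ≤ 2 * m * (Fintype.card V - 1) := by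
  refine card_le_mul_of_coord 1 (t := univ.erase v) ?_ (by simp [card_erase_of_mem])
    fun b hb ↦ ?_
  · simp only [mem_filter, mem_monoMatchings, mem_erase, mem_univ, and_true]
    rintro q ⟨⟨h, -⟩, rfl⟩ h1
    exact absurd (h h1) (by decide)
  · have hb' : v ≠ b := (mem_erase.1 hb).1.symm
    refine (card_le_mul_card_image_of_maps_to (f := fun q ↦ s(q 2, q 3))
      (t := sameColour χ s(v, b)) ?_ 2 fun e _ ↦ ?_).trans
        (Nat.mul_le_mul_left 2 (hm s(v, b) (by simpa using hb')))
    · simp only [mem_filter, mem_monoMatchings, mem_sameColour, Sym2.mk_isDiag_iff]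
      rintro q ⟨⟨⟨h, hc⟩, rfl⟩, rfl⟩
      refine ⟨fun h1 ↦ absurd (h h1) (by decide), fun h1 ↦ ?_, hc.symm⟩
      rcases Sym2.eq_iff.1 h1 with h1 | h1 <;> exact absurd (h h1.1) (by decide)
    · induction e with | _ c d
      refine (card_le_card (t := {![v, b, c, d], ![v, b, d, c]}) fun q hq ↦ ?_).trans card_le_two
      simp only [mem_filter] at hq
      obtain ⟨⟨⟨-, h0⟩, h1⟩, h2⟩ := hq
      rw [mem_insert, mem_singleton]
      rcases Sym2.eq_iff.1 h2 with ⟨h2, h3⟩ | ⟨h2, h3⟩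
      · left
        ext i
        fin_cases i <;> simp_all
      · right
        ext i
        fin_cases i <;> simp_all

theorem card_monoMatchings_le (hm : ∀ e : Sym2 V, ¬e.IsDiag → #(sameColour χ e) ≤ m) :
    #(monoMatchings χ) ≤ 2 * m * (Fintype.card V - 1) * Fintype.card V :=
  card_le_mul_of_coord 0 (t := univ) (by simp) card_univ.le
    fun u _ ↦ card_monoMatchings_start_le hm u

theorem card_monoCherries_edge_le
    (hm : ∀ e : Sym2 V, ¬e.IsDiag → #(sameColour χ e) ≤ m)
    {v b : V} (h : v ≠ b) :
    #{q ∈ monoCherries χ | q 0 = v ∧ q 1 = b} ≤ m := by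
  refine (card_le_card_of_injOn (fun q ↦ s(q 1, q 2)) ?_ ?_).trans
    (hm s(v, b) (by simpa using h))
  · intro q hq
    simp only [coe_filter, Set.mem_ofPred_eq, mem_monoCherries] at hq
    obtain ⟨⟨hq, hc⟩, rfl, rfl⟩ := hq
    simp only [mem_coe, mem_sameColour, Sym2.mk_isDiag_iff]
    refine ⟨fun h1 ↦ absurd (hq h1) (by decide), fun h1 ↦ ?_, hc.symm⟩
    rcases Sym2.eq_iff.1 h1 with h1 | h1
    · exact absurd (hq h1.1) (by decide)
    · exact absurd (hq h1.2) (by decide)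
  · intro q hq r hr hqr
    simp only [coe_filter, Set.mem_ofPred_eq] at hq hr
    have h1 : q 2 = r 2 := by
      simp only [hq.2.2, hr.2.2] at hqr
      exact Sym2.congr_right.1 hqr
    ext i
    fin_cases i <;> simp_all

theorem card_monoCherries_start_le
    (hm : ∀ e : Sym2 V, ¬e.IsDiag → #(sameColour χ e) ≤ m)
    (v : V) :
    #{q ∈ monoCherries χ | q 0 = v} ≤ m * (Fintype.card V - 1) := by
  refine card_le_mul_of_coord 1 (t := univ.erase v) ?_ (by simp [card_erase_of_mem])
    fun b hb ↦ ?_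
  · simp only [mem_filter, mem_monoCherries, mem_erase, mem_univ, and_true]
    rintro q ⟨⟨h, -⟩, rfl⟩ h1
    exact absurd (h h1) (by decide)
  · rw [filter_filter]
    exact card_monoCherries_edge_le hm (mem_erase.1 hb).1.symm

theorem card_monoCherries_centre_le
    (hm : ∀ e : Sym2 V, ¬e.IsDiag → #(sameColour χ e) ≤ m)
    (v : V) :
    #{q ∈ monoCherries χ | q 1 = v} ≤ m * (Fintype.card V - 1) := by
  refine card_le_mul_of_coord 0 (t := univ.erase v) ?_ (by simp [card_erase_of_mem])
    fun b hb ↦ ?_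
  · simp only [mem_filter, mem_monoCherries, mem_erase, mem_univ, and_true]
    rintro q ⟨⟨h, -⟩, rfl⟩ h1
    exact absurd (h h1) (by decide)
  · rw [filter_filter]
    simp only [and_comm (a := _ = v)]
    exact card_monoCherries_edge_le hm (mem_erase.1 hb).1

theorem card_monoCherries_le (hm : ∀ e : Sym2 V, ¬e.IsDiag → #(sameColour χ e) ≤ m) :
    #(monoCherries χ) ≤ m * (Fintype.card V - 1) * Fintype.card V :=
  card_le_mul_of_coord 0 (t := univ) (by simp) card_univ.le
    fun u _ ↦ card_monoCherries_start_le hm u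

end Colouring

end Counting

/-! ### Bad partial maps and their weights -/

section Events

variable {V W C : Type*} [Fintype V] [Fintype W] [DecidableEq V] [DecidableEq W] [DecidableEq C]

section Bad

variable (G : SimpleGraph V) [DecidableRel G.Adj] (χ : Sym2 W → C)

/-- The partial maps that send two disjoint edges of `G` to edges of the same colour. -/
def badMatchings : Finset (Finset (V × W)) := pairings (matchings G) (monoMatchings χ)

/-- The partial maps that send two adjacent edges of `G` to edges of the same colour. -/
def badCherries : Finset (Finset (V × W)) := pairings (cherries G) (monoCherries χ)

/-- The symmetries of an ordered pair of oriented disjoint edges act transitively on the four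
indices, so that a given vertex may always be taken to be the one with index `0`. -/
theorem exists_perm_matchings (i : Fin 4) : ∃ s : Equiv.Perm (Fin 4), s 0 = i ∧
    (∀ p ∈ matchings G, p ∘ s ∈ matchings G) ∧ ∀ q ∈ monoMatchings χ, q ∘ s ∈ monoMatchings χ := by
  have key : ∃ s : Equiv.Perm (Fin 4), s 0 = i ∧
      ((s 0 = 0 ∧ s 1 = 1 ∧ s 2 = 2 ∧ s 3 = 3) ∨ (s 0 = 1 ∧ s 1 = 0 ∧ s 2 = 2 ∧ s 3 = 3) ∨
      (s 0 = 2 ∧ s 1 = 3 ∧ s 2 = 0 ∧ s 3 = 1) ∨ (s 0 = 3 ∧ s 1 = 2 ∧ s 2 = 1 ∧ s 3 = 0)) := by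
    fin_cases i
    · exact ⟨1, by decide⟩
    · exact ⟨Equiv.swap 0 1, by decide⟩
    · exact ⟨Equiv.addRight 2, by decide⟩
    · exact ⟨Fin.revPerm, by decide⟩
  obtain ⟨s, hs, key⟩ := key
  refine ⟨s, hs, fun p hp ↦ ?_, fun q hq ↦ ?_⟩
  · rw [mem_matchings] at hp ⊢
    refine ⟨hp.1.comp s.injective, ?_⟩
    rcases key with ⟨h0, h1, h2, h3⟩ | ⟨h0, h1, h2, h3⟩ | ⟨h0, h1, h2, h3⟩ | ⟨h0, h1, h2, h3⟩ <;>
    simp [h0, h1, h2, h3, hp.2, G.adj_comm]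
  · rw [mem_monoMatchings] at hq ⊢
    refine ⟨hq.1.comp s.injective, ?_⟩
    rcases key with ⟨h0, h1, h2, h3⟩ | ⟨h0, h1, h2, h3⟩ | ⟨h0, h1, h2, h3⟩ | ⟨h0, h1, h2, h3⟩ <;>
    simp [h0, h1, h2, h3, hq.2, Sym2.eq_swap]

variable {G χ}

theorem comp_swap_mem_matchings {p : Fin 4 → V} (hp : p ∈ matchings G) :
    p ∘ Equiv.swap 2 3 ∈ matchings G := by
  rw [mem_matchings] at hp ⊢
  refine ⟨hp.1.comp (Equiv.injective _), hp.2.1, hp.2.2.symm⟩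

theorem comp_swap_mem_monoMatchings {q : Fin 4 → W} (hq : q ∈ monoMatchings χ) :
    q ∘ Equiv.swap 2 3 ∈ monoMatchings χ := by
  rw [mem_monoMatchings] at hq ⊢
  refine ⟨hq.1.comp (Equiv.injective _), hq.2.trans (congrArg χ Sym2.eq_swap)⟩

theorem comp_rev_mem_cherries {p : Fin 3 → V} (hp : p ∈ cherries G) :
    p ∘ Fin.revPerm ∈ cherries G := by
  rw [mem_cherries] at hp ⊢
  exact ⟨hp.1.comp (Equiv.injective _), hp.2.2.symm, hp.2.1.symm⟩

theorem comp_rev_mem_monoCherries {q : Fin 3 → W} (hq : q ∈ monoCherries χ) :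
    q ∘ Fin.revPerm ∈ monoCherries χ := by
  rw [mem_monoCherries] at hq ⊢
  refine ⟨hq.1.comp (Equiv.injective _), ?_⟩
  have h := hq.2.symm
  rwa [Sym2.eq_swap, Sym2.eq_swap (a := q 0)] at h

variable {Δ m : ℕ}

/-- After moving `u` to index `0`, the orientation of the edge not containing `u` is still free,
which saves a factor of two. -/
theorem card_badMatchings_fst_le (hΔ : ∀ v, G.degree v ≤ Δ)
    (hm : ∀ e : Sym2 W, ¬e.IsDiag → #(sameColour χ e) ≤ m)
    (hn : Fintype.card V = Fintype.card W) (u : V) :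
    #{τ ∈ badMatchings G χ | ∃ x ∈ τ, x.1 = u} ≤
      Δ ^ 2 * Fintype.card W ^ 2 * (Fintype.card W - 1) * m := by
  have h1 : {τ ∈ badMatchings G χ | ∃ x ∈ τ, x.1 = u} ⊆
      pairings {p ∈ matchings G | p 0 = u} (monoMatchings χ) := by
    intro τ hτ
    simp only [mem_filter, badMatchings, pairings, mem_image₂] at hτ
    obtain ⟨⟨p, hp, q, hq, rfl⟩, x, hx, rfl⟩ := hτ
    obtain ⟨i, rfl⟩ := mem_pairing.1 hx
    obtain ⟨s, rfl, hP, hQ⟩ := exists_perm_matchings G χ i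
    exact pairing_mem_pairings_of_fst hp hq s 0 hP hQ
  have h2 : 2 * #(pairings {p ∈ matchings G | p 0 = u} (monoMatchings χ)) ≤ _ :=
    two_mul_card_pairings_le (Equiv.swap 2 3) (by decide) (fun p hp ↦ by
      rw [mem_filter] at hp
      exact ⟨(mem_matchings.1 hp.1).1, mem_filter.2 ⟨comp_swap_mem_matchings hp.1, hp.2⟩⟩)
      fun q hq ↦ comp_swap_mem_monoMatchings hq
  have h3 := Nat.mul_le_mul (card_matchings_start_le hΔ u) (card_monoMatchings_le hm)
  rw [hn] at h3
  have h4 := card_le_card h1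
  have h5 : 1 * Δ * Fintype.card W * Δ * (2 * m * (Fintype.card W - 1) * Fintype.card W) =
    2 * (Δ ^ 2 * Fintype.card W ^ 2 * (Fintype.card W - 1) * m) := by ring
  omega

theorem card_badMatchings_snd_le (hΔ : ∀ v, G.degree v ≤ Δ)
    (hm : ∀ e : Sym2 W, ¬e.IsDiag → #(sameColour χ e) ≤ m)
    (hn : Fintype.card V = Fintype.card W) (v : W) :
    #{τ ∈ badMatchings G χ | ∃ x ∈ τ, x.2 = v} ≤
      Δ ^ 2 * Fintype.card W ^ 2 * (Fintype.card W - 1) * m := by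
  have h1 : {τ ∈ badMatchings G χ | ∃ x ∈ τ, x.2 = v} ⊆
      pairings (matchings G) {q ∈ monoMatchings χ | q 0 = v} := by
    intro τ hτ
    simp only [mem_filter, badMatchings, pairings, mem_image₂] at hτ
    obtain ⟨⟨p, hp, q, hq, rfl⟩, x, hx, rfl⟩ := hτ
    obtain ⟨i, rfl⟩ := mem_pairing.1 hx
    obtain ⟨s, rfl, hP, hQ⟩ := exists_perm_matchings G χ i
    exact pairing_mem_pairings_of_snd hp hq s 0 hP hQ
  have h2 : 2 * #(pairings (matchings G) {q ∈ monoMatchings χ | q 0 = v}) ≤ _ :=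
    two_mul_card_pairings_le (Equiv.swap 2 3) (by decide) (fun p hp ↦
      ⟨(mem_matchings.1 hp).1, comp_swap_mem_matchings hp⟩)
      fun q hq ↦ by
        rw [mem_filter] at hq ⊢
        exact ⟨comp_swap_mem_monoMatchings hq.1, hq.2⟩
  have h3 := Nat.mul_le_mul (card_matchings_le hΔ) (card_monoMatchings_start_le hm v)
  rw [hn] at h3
  have h4 := card_le_card h1
  have h5 : 1 * Δ * Fintype.card W * Δ * Fintype.card W * (2 * m * (Fintype.card W - 1)) =
    2 * (Δ ^ 2 * Fintype.card W ^ 2 * (Fintype.card W - 1) * m) := by ring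
  omega

/-- The vertex `u` is either an end of the path of two edges or its centre; in the second case
reversing the path saves a factor of two, which gives `1 + 1 / 2 = 3 / 2`. -/
theorem two_mul_card_badCherries_fst_le (hΔ : ∀ v, G.degree v ≤ Δ)
    (hm : ∀ e : Sym2 W, ¬e.IsDiag → #(sameColour χ e) ≤ m) (u : V) :
    2 * #{τ ∈ badCherries G χ | ∃ x ∈ τ, x.1 = u} ≤
      3 * (Δ ^ 2 * Fintype.card W * (Fintype.card W - 1) * m) := by
  have h1 : {τ ∈ badCherries G χ | ∃ x ∈ τ, x.1 = u} ⊆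
      pairings {p ∈ cherries G | p 0 = u} (monoCherries χ) ∪
      pairings {p ∈ cherries G | p 1 = u} (monoCherries χ) := by
    intro τ hτ
    simp only [mem_filter, badCherries, pairings, mem_image₂] at hτ
    obtain ⟨⟨p, hp, q, hq, rfl⟩, x, hx, rfl⟩ := hτ
    obtain ⟨i, rfl⟩ := mem_pairing.1 hx
    rw [mem_union]
    fin_cases i
    · exact .inl (pairing_mem_pairings_of_fst hp hq 1 0 (fun _ h ↦ h) fun _ h ↦ h)
    · exact .inr (pairing_mem_pairings_of_fst hp hq 1 1 (fun _ h ↦ h) fun _ h ↦ h)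
    · exact .inl (pairing_mem_pairings_of_fst hp hq Fin.revPerm 0
        (fun _ ↦ comp_rev_mem_cherries) fun _ ↦ comp_rev_mem_monoCherries)
  have h2 : 2 * #(pairings {p ∈ cherries G | p 1 = u} (monoCherries χ)) ≤ _ :=
    two_mul_card_pairings_le Fin.revPerm (by decide) (fun p hp ↦ by
      rw [mem_filter] at hp
      exact ⟨(mem_cherries.1 hp.1).1, mem_filter.2 ⟨comp_rev_mem_cherries hp.1, hp.2⟩⟩)
      fun q hq ↦ comp_rev_mem_monoCherries hq
  have h3 := Nat.mul_le_mul (card_cherries_centre_le hΔ u) (card_monoCherries_le hm)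
  have h4 := (card_le_card h1).trans (card_union_le _ _)
  have h5 := (card_pairings_le {p ∈ cherries G | p 0 = u} (monoCherries χ)).trans
    (Nat.mul_le_mul (card_cherries_start_le hΔ u) (card_monoCherries_le hm))
  have h6 : 1 * Δ * Δ * (m * (Fintype.card W - 1) * Fintype.card W) =
    Δ ^ 2 * Fintype.card W * (Fintype.card W - 1) * m := by ring
  omega

theorem two_mul_card_badCherries_snd_le (hΔ : ∀ v, G.degree v ≤ Δ)
    (hm : ∀ e : Sym2 W, ¬e.IsDiag → #(sameColour χ e) ≤ m)
    (hn : Fintype.card V = Fintype.card W) (v : W) :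
    2 * #{τ ∈ badCherries G χ | ∃ x ∈ τ, x.2 = v} ≤
      3 * (Δ ^ 2 * Fintype.card W * (Fintype.card W - 1) * m) := by
  have h1 : {τ ∈ badCherries G χ | ∃ x ∈ τ, x.2 = v} ⊆
      pairings (cherries G) {q ∈ monoCherries χ | q 0 = v} ∪
      pairings (cherries G) {q ∈ monoCherries χ | q 1 = v} := by
    intro τ hτ
    simp only [mem_filter, badCherries, pairings, mem_image₂] at hτ
    obtain ⟨⟨p, hp, q, hq, rfl⟩, x, hx, rfl⟩ := hτ
    obtain ⟨i, rfl⟩ := mem_pairing.1 hx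
    rw [mem_union]
    fin_cases i
    · exact .inl (pairing_mem_pairings_of_snd hp hq 1 0 (fun _ h ↦ h) fun _ h ↦ h)
    · exact .inr (pairing_mem_pairings_of_snd hp hq 1 1 (fun _ h ↦ h) fun _ h ↦ h)
    · exact .inl (pairing_mem_pairings_of_snd hp hq Fin.revPerm 0
        (fun _ ↦ comp_rev_mem_cherries) fun _ ↦ comp_rev_mem_monoCherries)
  have h2 : 2 * #(pairings (cherries G) {q ∈ monoCherries χ | q 1 = v}) ≤ _ :=
    two_mul_card_pairings_le Fin.revPerm (by decide) (fun p hp ↦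
      ⟨(mem_cherries.1 hp).1, comp_rev_mem_cherries hp⟩)
      fun q hq ↦ by
        rw [mem_filter] at hq ⊢
        exact ⟨comp_rev_mem_monoCherries hq.1, hq.2⟩
  have h3 := Nat.mul_le_mul (card_cherries_le hΔ) (card_monoCherries_centre_le hm v)
  have h4 := (card_le_card h1).trans (card_union_le _ _)
  have h5 := (card_pairings_le (cherries G) {q ∈ monoCherries χ | q 0 = v}).trans
    (Nat.mul_le_mul (card_cherries_le hΔ) (card_monoCherries_start_le hm v))
  rw [hn] at h3 h5
  have h6 : 1 * Δ * Δ * Fintype.card W * (m * (Fintype.card W - 1)) =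
    Δ ^ 2 * Fintype.card W * (Fintype.card W - 1) * m := by ring
  omega

end Bad

end Events

/-! ### The local lemma applied to bad partial maps -/

section Weights

variable {V W : Type*}

/-- The weight of a bad partial map in the local lemma: a constant multiple of the probability that
a random bijection onto an `n`-element set extends it, where the constants `16 / 5` for two disjoint
edges and `12 / 5` for two adjacent edges make the total weight of the bad partial maps at
any vertex at most `2 / 15`. -/
noncomputable def weight (n : ℕ) (τ : Finset (V × W)) : ℝ :=
  if #τ = 4 then 16 / 5 / n.descFactorial 4 else 12 / 5 / n.descFactorial 3

theorem weight_nonneg (n : ℕ) (τ : Finset (V × W)) : 0 ≤ weight n τ := by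
  unfold weight
  split_ifs <;> positivity

variable [DecidableEq V] [DecidableEq W]

/-- Bounds on the numbers of bad partial maps at a vertex turn into a bound on their total weight:
`(16 / 5 + 3 / 2 * (12 / 5)) / 51 = 2 / 15`. -/
theorem sum_weight_le {n Δ m : ℕ} (hΔ : 1 ≤ Δ) (hn : 51 * Δ ^ 2 * (m + 1) ≤ n)
    {S T : Finset (Finset (V × W))} (hS : ∀ τ ∈ S, #τ = 4) (hT : ∀ τ ∈ T, #τ = 3)
    (hS' : #S ≤ Δ ^ 2 * n ^ 2 * (n - 1) * m)
    (hT' : 2 * #T ≤ 3 * (Δ ^ 2 * n * (n - 1) * m)) :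
    ∑ τ ∈ S ∪ T, weight n τ ≤ 2 / 15 := by
  have h51 : 51 ≤ n := by nlinarith [Nat.one_le_pow 2 Δ hΔ]
  obtain ⟨N, rfl⟩ : ∃ N, n = N + 3 := ⟨n - 3, by omega⟩
  have hd4 : ((N + 3).descFactorial 4 : ℝ) = (N + 3) * (N + 2) * ((N + 1) * N) := by
    simp only [Nat.descFactorial_succ, Nat.descFactorial_zero]
    push_cast [Nat.add_sub_cancel, show N + 3 - 1 = N + 2 by omega,
      show N + 3 - 2 = N + 1 by omega]
    ring
  have hd3 : ((N + 3).descFactorial 3 : ℝ) = (N + 3) * (N + 2) * (N + 1) := by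
    simp only [Nat.descFactorial_succ, Nat.descFactorial_zero]
    push_cast [show N + 3 - 1 = N + 2 by omega, show N + 3 - 2 = N + 1 by omega]
    ring
  have h1 : ∑ τ ∈ S, weight (N + 3) τ = #S * (16 / 5 / (N + 3).descFactorial 4) := by
    rw [← nsmul_eq_mul]
    exact sum_eq_card_nsmul fun τ hτ ↦ by rw [weight, if_pos (hS τ hτ)]
  have h2 : ∑ τ ∈ T, weight (N + 3) τ = #T * (12 / 5 / (N + 3).descFactorial 3) := by
    rw [← nsmul_eq_mul]
    exact sum_eq_card_nsmul fun τ hτ ↦ by rw [weight, if_neg (by simp [hT τ hτ])]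
  have hST : Disjoint S T := disjoint_left.2 fun τ h3 h4 ↦ by
    have := hS τ h3
    have := hT τ h4
    omega
  rw [sum_union hST, h1, h2, hd4, hd3]
  rw [show N + 3 - 1 = N + 2 by omega] at hS' hT'
  have hN : (48 : ℝ) ≤ N := by exact_mod_cast (show 48 ≤ N by omega)
  have hΔ' : (1 : ℝ) ≤ (Δ : ℝ) ^ 2 := by exact_mod_cast Nat.one_le_pow 2 Δ hΔ
  have hn' : 51 * (Δ : ℝ) ^ 2 * (m + 1) ≤ N + 3 := by exact_mod_cast hn
  have hS'' : (#S : ℝ) ≤ Δ ^ 2 * (N + 3) ^ 2 * (N + 2) * m := by exact_mod_cast hS'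
  have hT'' : (2 * #T : ℝ) ≤ 3 * (Δ ^ 2 * (N + 3) * (N + 2) * m) := by exact_mod_cast hT'
  -- The `+ 1` in `m + 1` pays for replacing `n` by `n - 2` and `n - 3` in the denominators.
  have h3 : 51 * ((Δ : ℝ) ^ 2 * m) ≤ N - 48 := by linarith
  have h4 : #S * (16 / 5 / (((N : ℝ) + 3) * (N + 2) * ((N + 1) * N))) ≤ 16 / 5 / 51 := by
    rw [mul_div_assoc', div_le_iff₀ (by positivity)]
    have h5 : 51 * ((Δ : ℝ) ^ 2 * m) * (N + 3) ≤ (N + 1) * N := by nlinarith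
    have h6 := mul_le_mul_of_nonneg_right h5 (show (0 : ℝ) ≤ (N + 3) * (N + 2) by positivity)
    linarith
  have h7 : #T * (12 / 5 / (((N : ℝ) + 3) * (N + 2) * (N + 1))) ≤ 18 / 5 / 51 := by
    rw [mul_div_assoc', div_le_iff₀ (by positivity)]
    have h5 : 51 * ((Δ : ℝ) ^ 2 * m) ≤ N + 1 := by linarith
    have h6 := mul_le_mul_of_nonneg_right h5 (show (0 : ℝ) ≤ (N + 3) * (N + 2) by positivity)
    linarith
  linarith

theorem exp_sixteen_fifteenths_le : Real.exp (4 * (4 / 15)) ≤ 16 / 5 := by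
  have h1 : Real.exp (4 * (4 / 15)) * Real.exp (-(1 / 15)) = Real.exp 1 := by
    rw [← Real.exp_add]
    norm_num
  have h2 := Real.add_one_le_exp (-(1 / 15) : ℝ)
  nlinarith [Real.exp_one_lt_d9, Real.exp_pos (4 * (4 / 15))]

theorem exp_four_fifths_le : Real.exp (3 * (4 / 15)) ≤ 12 / 5 := by
  have h1 : Real.exp (3 * (4 / 15)) * Real.exp (1 / 5) = Real.exp 1 := by
    rw [← Real.exp_add]
    norm_num
  have h2 := Real.add_one_le_exp (1 / 5 : ℝ)
  nlinarith [Real.exp_one_lt_d9, Real.exp_pos (3 * (4 / 15))]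

/-- The partial maps in `B` that are not disjoint from `σ` in domain and range. -/
def conflicts (B : Finset (Finset (V × W))) (σ : Finset (V × W)) : Finset (Finset (V × W)) :=
  {τ ∈ B | ∃ x ∈ σ, ∃ y ∈ τ, y.1 = x.1 ∨ y.2 = x.2}

/-- The product is at most the exponential of the total weight of the conflicts, each of which is
charged to a vertex of the domain or of the range of `σ`. -/
theorem prod_conflicts_le (B : Finset (Finset (V × W))) (μ : Finset (V × W) → ℝ)
    (hμ : ∀ τ, 0 ≤ μ τ) {c : ℝ}
    (h1 : ∀ u : V, ∑ τ ∈ B with ∃ x ∈ τ, x.1 = u, μ τ ≤ c)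
    (h2 : ∀ v : W, ∑ τ ∈ B with ∃ x ∈ τ, x.2 = v, μ τ ≤ c) (σ : Finset (V × W)) :
    ∏ τ ∈ conflicts B σ, (1 + μ τ) ≤ Real.exp (#σ * (2 * c)) := by
  calc ∏ τ ∈ conflicts B σ, (1 + μ τ) ≤ ∏ τ ∈ conflicts B σ, Real.exp (μ τ) :=
        prod_le_prod (fun τ _ ↦ by linarith [hμ τ]) fun τ _ ↦ by
          linarith [Real.add_one_le_exp (μ τ)]
    _ = Real.exp (∑ τ ∈ conflicts B σ, μ τ) := (Real.exp_sum _ _).symm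
    _ ≤ _ := Real.exp_le_exp.2 ?_
  calc ∑ τ ∈ conflicts B σ, μ τ
      ≤ ∑ τ ∈ B, ∑ x ∈ σ, ((if ∃ y ∈ τ, y.1 = x.1 then μ τ else 0) +
          if ∃ y ∈ τ, y.2 = x.2 then μ τ else 0) := by
        rw [conflicts, sum_filter]
        refine sum_le_sum fun τ _ ↦ ?_
        have hnn : ∀ x ∈ σ, 0 ≤ (if ∃ y ∈ τ, y.1 = x.1 then μ τ else 0) +
            if ∃ y ∈ τ, y.2 = x.2 then μ τ else 0 := fun x _ ↦ by
          have := hμ τ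
          split_ifs <;> positivity
        split_ifs with h
        · obtain ⟨x, hx, y, hy, hxy⟩ := h
          refine le_trans ?_ (single_le_sum hnn hx)
          have := hμ τ
          rcases hxy with hxy | hxy
          · rw [if_pos ⟨y, hy, hxy⟩]
            split_ifs <;> linarith
          · rw [if_pos (c := ∃ y ∈ τ, y.2 = x.2) ⟨y, hy, hxy⟩]
            split_ifs <;> linarith
        · exact sum_nonneg hnn
    _ = ∑ x ∈ σ, (∑ τ ∈ B with ∃ y ∈ τ, y.1 = x.1, μ τ +
          ∑ τ ∈ B with ∃ y ∈ τ, y.2 = x.2, μ τ) := by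
        rw [sum_comm]
        simp only [sum_add_distrib, sum_filter]
    _ ≤ ∑ _x ∈ σ, 2 * c := sum_le_sum fun x _ ↦ by linarith [h1 x.1, h2 x.2]
    _ = #σ * (2 * c) := by rw [sum_const, nsmul_eq_mul]

variable [Fintype V] [Fintype W]

/-- The hypothesis of the local lemma for the event that a bijection extends `p ↦ q`. -/
theorem card_avoiding_inter_mul_prod_le {ι : Type*} [Fintype ι] [DecidableEq ι]
    {p : ι → V} {q : ι → W} (hp : Function.Injective p) (hq : Function.Injective q)
    (hι : Fintype.card ι ≤ Fintype.card W)
    {B S : Finset (Finset (V × W))} (hSB : S ⊆ B)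
    (hS : Disjoint S (conflicts B (pairing p q))) (μ : Finset (V × W) → ℝ) {a : ℝ}
    (ha : 0 ≤ a) (hprod : ∏ τ ∈ conflicts B (pairing p q), (1 + μ τ) ≤ a) :
    #(avoiding extending S ∩ extending (pairing p q)) *
      ∏ τ ∈ conflicts B (pairing p q), (1 + μ τ) ≤
    a / (Fintype.card W).descFactorial (Fintype.card ι) * #(avoiding extending S) := by
  have h1 := descFactorial_mul_card_avoiding_inter_extending_le p hp hq S fun τ hτ x hx ↦ by
    have h2 : ∀ i, ¬(x.1 = p i ∨ x.2 = q i) := fun i hi ↦ disjoint_left.1 hS hτ <|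
      mem_filter.2 ⟨hSB hτ, (p i, q i), mem_pairing.2 ⟨i, rfl⟩, x, hx, hi⟩
    exact ⟨fun i hi ↦ h2 i (.inl hi), fun i hi ↦ h2 i (.inr hi)⟩
  have hd : (0 : ℝ) < (Fintype.card W).descFactorial (Fintype.card ι) := by
    exact_mod_cast Nat.descFactorial_pos.2 hι
  have h2 : ((Fintype.card W).descFactorial (Fintype.card ι) : ℝ) *
      #(avoiding extending S ∩ extending (pairing p q)) ≤ #(avoiding extending S) := by
    exact_mod_cast h1
  rw [div_mul_eq_mul_div, le_div_iff₀ hd]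
  calc _ ≤ #(avoiding extending S ∩ extending (pairing p q)) * a *
        (Fintype.card W).descFactorial (Fintype.card ι) := by gcongr
    _ = a * ((Fintype.card W).descFactorial (Fintype.card ι) *
        #(avoiding extending S ∩ extending (pairing p q))) := by ring
    _ ≤ _ := by gcongr

end Weights

/-! ### Rainbow copies -/

section Rainbow

variable {V W C : Type*} [Fintype V] [Fintype W] [DecidableEq V] [DecidableEq W] [DecidableEq C]
  {G : SimpleGraph V} [DecidableRel G.Adj] {χ : Sym2 W → C} {Δ m : ℕ}

/-- The local lemma applies: a neighbourhood of a bad partial map with `r` pairs has total weight at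
most `r * (4 / 15)`, and `exp (4 * (4 / 15)) ≤ 16 / 5`, `exp (3 * (4 / 15)) ≤ 12 / 5`. -/
theorem exists_avoiding_bad (hΔ0 : 1 ≤ Δ) (hΔ : ∀ v, G.degree v ≤ Δ)
    (hm : ∀ e : Sym2 W, ¬e.IsDiag → #(sameColour χ e) ≤ m)
    (hn : Fintype.card V = Fintype.card W) (hm' : 51 * Δ ^ 2 * (m + 1) ≤ Fintype.card W) :
    ∃ φ : V ≃ W, ∀ τ ∈ badMatchings G χ ∪ badCherries G χ, φ ∉ extending τ := by
  have hn4 : 4 ≤ Fintype.card W := by nlinarith [Nat.one_le_pow 2 Δ hΔ0]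
  have : Nonempty (V ≃ W) := Fintype.card_eq.1 hn
  have hS4 : ∀ τ ∈ badMatchings G χ, #τ = 4 := fun τ hτ ↦ by
    obtain ⟨p, hp, q, -, rfl⟩ := mem_image₂.1 hτ
    exact card_pairing (mem_matchings.1 hp).1 q
  have hT3 : ∀ τ ∈ badCherries G χ, #τ = 3 := fun τ hτ ↦ by
    obtain ⟨p, hp, q, -, rfl⟩ := mem_image₂.1 hτ
    exact card_pairing (mem_cherries.1 hp).1 q
  have hsum : ∀ (P : Finset (V × W) → Prop) [DecidablePred P],
      #{τ ∈ badMatchings G χ | P τ} ≤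
        Δ ^ 2 * Fintype.card W ^ 2 * (Fintype.card W - 1) * m →
      2 * #{τ ∈ badCherries G χ | P τ} ≤
        3 * (Δ ^ 2 * Fintype.card W * (Fintype.card W - 1) * m) →
      ∑ τ ∈ badMatchings G χ ∪ badCherries G χ with P τ, weight (Fintype.card W) τ ≤ 2 / 15 := by
    intro P _ h4 h3
    rw [filter_union]
    exact sum_weight_le hΔ0 hm' (fun τ hτ ↦ hS4 τ (mem_filter.1 hτ).1)
      (fun τ hτ ↦ hT3 τ (mem_filter.1 hτ).1) h4 h3
  have hprod := prod_conflicts_le (badMatchings G χ ∪ badCherries G χ)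
    (weight (Fintype.card W)) (weight_nonneg _)
    (fun u ↦ hsum _ (card_badMatchings_fst_le hΔ hm hn u)
      (two_mul_card_badCherries_fst_le hΔ hm u))
    (fun v ↦ hsum _ (card_badMatchings_snd_le hΔ hm hn v)
      (two_mul_card_badCherries_snd_le hΔ hm hn v))
  obtain ⟨φ, hφ⟩ := avoiding_nonempty (extending (V := V) (W := W)) (weight (Fintype.card W))
    (weight_nonneg _) (badMatchings G χ ∪ badCherries G χ)
    (conflicts (badMatchings G χ ∪ badCherries G χ)) (fun σ hσ ↦ by
      obtain ⟨x, hx⟩ : σ.Nonempty := by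
        rw [← card_pos]
        rcases mem_union.1 hσ with h | h
        · simp [hS4 σ h]
        · simp [hT3 σ h]
      exact mem_filter.2 ⟨hσ, x, hx, x, hx, .inl rfl⟩) (fun σ hσ S hSB hS ↦ by
      have hp := hprod σ
      rcases mem_union.1 hσ with h | h
      · rw [hS4 σ h] at hp
        rw [weight, if_pos (hS4 σ h)]
        obtain ⟨p, hp', q, hq, rfl⟩ := mem_image₂.1 h
        refine card_avoiding_inter_mul_prod_le (mem_matchings.1 hp').1
          (mem_monoMatchings.1 hq).1 (by simpa using hn4) hSB hS _ (by norm_num)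
          (hp.trans (le_trans (le_of_eq ?_) exp_sixteen_fifteenths_le))
        norm_num
      · rw [hT3 σ h] at hp
        rw [weight, if_neg (by simp [hT3 σ h])]
        obtain ⟨p, hp', q, hq, rfl⟩ := mem_image₂.1 h
        refine card_avoiding_inter_mul_prod_le (mem_cherries.1 hp').1
          (mem_monoCherries.1 hq).1 (by simpa using (by omega : 3 ≤ Fintype.card W)) hSB hS _
          (by norm_num) (hp.trans (le_trans (le_of_eq ?_) exp_four_fifths_le))
        norm_num)
  exact ⟨φ, mem_avoiding.1 hφ⟩

theorem colour_ne_of_adjacent {φ : V ≃ W} (hφ : ∀ τ ∈ badCherries G χ, φ ∉ extending τ)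
    {x y z : V} (hxy : G.Adj x y) (hyz : G.Adj y z) (hxz : x ≠ z) :
    χ s(φ x, φ y) ≠ χ s(φ y, φ z) := by
  intro h
  have hp : Function.Injective ![x, y, z] := by
    intro i j hij
    fin_cases i <;> fin_cases j <;> simp_all [hxy.ne, hxy.ne', hyz.ne, hyz.ne', hxz.symm]
  refine hφ (pairing ![x, y, z] (φ ∘ ![x, y, z])) (mem_image₂_of_mem ?_ ?_)
    (mem_extending_pairing.2 fun i ↦ rfl)
  · exact mem_cherries.2 ⟨hp, hxy, hyz⟩
  · exact mem_monoCherries.2 ⟨φ.injective.comp hp, h⟩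

theorem colour_ne_of_disjoint {φ : V ≃ W} (hφ : ∀ τ ∈ badMatchings G χ, φ ∉ extending τ)
    {x y z w : V} (hxy : G.Adj x y) (hzw : G.Adj z w) (hxz : x ≠ z) (hxw : x ≠ w) (hyz : y ≠ z)
    (hyw : y ≠ w) : χ s(φ x, φ y) ≠ χ s(φ z, φ w) := by
  intro h
  have hp : Function.Injective ![x, y, z, w] := by
    intro i j hij
    fin_cases i <;> fin_cases j <;>
      simp_all [hxy.ne, hxy.ne', hzw.ne, hzw.ne', hxz.symm, hxw.symm, hyz.symm, hyw.symm]
  refine hφ (pairing ![x, y, z, w] (φ ∘ ![x, y, z, w])) (mem_image₂_of_mem ?_ ?_)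
    (mem_extending_pairing.2 fun i ↦ rfl)
  · exact mem_matchings.2 ⟨hp, hxy, hzw⟩
  · exact mem_monoMatchings.2 ⟨φ.injective.comp hp, h⟩

/-- Here `m` bounds the number of further edges of the same colour as a given edge, so that the
colouring is `(m + 1)`-bounded. -/
theorem exists_rainbow_equiv (hΔ0 : 1 ≤ Δ) (hΔ : ∀ v, G.degree v ≤ Δ)
    (hm : ∀ e : Sym2 W, ¬e.IsDiag → #(sameColour χ e) ≤ m)
    (hn : Fintype.card V = Fintype.card W) (hm' : 51 * Δ ^ 2 * (m + 1) ≤ Fintype.card W) :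
    ∃ φ : V ≃ W, ∀ e ∈ G.edgeSet, ∀ f ∈ G.edgeSet, χ (e.map φ) = χ (f.map φ) → e = f := by
  obtain ⟨φ, hφ⟩ := exists_avoiding_bad hΔ0 hΔ hm hn hm'
  have h4 := fun τ hτ ↦ hφ τ (mem_union_left _ hτ)
  have h3 := fun τ hτ ↦ hφ τ (mem_union_right _ hτ)
  refine ⟨φ, fun e he f hf hc ↦ ?_⟩
  induction e with | _ x y
  induction f with | _ z w
  rw [SimpleGraph.mem_edgeSet] at he hf
  simp only [Sym2.map_mk] at hc
  by_contra hne
  by_cases hxz : x = z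
  · subst hxz
    refine colour_ne_of_adjacent h3 he.symm hf (fun h ↦ hne (by rw [h])) ?_
    rwa [Sym2.eq_swap]
  by_cases hxw : x = w
  · subst hxw
    refine colour_ne_of_adjacent h3 he.symm hf.symm (fun h ↦ hne (by rw [h, Sym2.eq_swap])) ?_
    rwa [Sym2.eq_swap, Sym2.eq_swap (a := φ x) (b := φ z)]
  by_cases hyz : y = z
  · subst hyz
    exact colour_ne_of_adjacent h3 he hf hxw hc
  by_cases hyw : y = w
  · subst hyw
    refine colour_ne_of_adjacent h3 he hf.symm hxz ?_
    rwa [Sym2.eq_swap (a := φ y) (b := φ z)]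
  exact colour_ne_of_disjoint h4 he hf hxz hxw hyz hyw hc

end Rainbow

/-- In order to apply `exists_rainbow_equiv`, the colouring is extended to all of `Sym2 (Fin n)` by
an arbitrary value on the diagonal, and `k` is replaced by its integer part. -/
theorem hasRainbowCopy_of_le {n : ℕ} {V C : Type*} [Fintype V] (G : SimpleGraph V)
    [DecidableRel G.Adj] (hV : Fintype.card V = n) (hG : 0 < G.maxDegree) {k : ℝ}
    (hk : k ≤ (n : ℝ) / (51 * (G.maxDegree : ℝ) ^ 2))
    (χ : (SimpleGraph.completeGraph (Fin n)).EdgeLabeling C) (hχ : IsBoundedColouring χ k) :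
    HasRainbowCopy χ G := by
  classical
  -- An edge of `G` shows that the complete graph has an edge, whose colour forces `1 ≤ k`.
  obtain ⟨u, v, huv⟩ : ∃ u v, G.Adj u v := by
    by_contra! h
    have : G.maxDegree ≤ 0 := G.maxDegree_le_of_forall_degree_le 0 fun v ↦ by
      simp [SimpleGraph.degree, SimpleGraph.neighborFinset_eq_filter, h]
    omega
  have hn : Fintype.card V = Fintype.card (Fin n) := by rw [hV, Fintype.card_fin]
  obtain ⟨ψ⟩ := Fintype.card_eq.1 hn
  let e₀ : (SimpleGraph.completeGraph (Fin n)).edgeSet :=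
    ⟨s(ψ u, ψ v), by simpa using huv.ne⟩
  let χ' : Sym2 (Fin n) → C := fun e ↦
    if h : e ∈ (SimpleGraph.completeGraph (Fin n)).edgeSet then χ ⟨e, h⟩ else χ e₀
  have hχ' : ∀ e : (SimpleGraph.completeGraph (Fin n)).edgeSet, χ' e = χ e :=
    fun e ↦ dif_pos e.2
  have hcard : ∀ e : (SimpleGraph.completeGraph (Fin n)).edgeSet,
      #(sameColour χ' e) + 1 ≤ ⌊k⌋₊ := by
    intro e
    refine Nat.le_floor (le_trans ?_ (hχ (χ e)).2)
    have h1 : #(sameColour χ' e) + 1 = #(insert e.1 (sameColour χ' e)) :=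
      (card_insert_of_notMem fun h ↦ (mem_sameColour.1 h).2.1 rfl).symm
    rw [h1, ← Set.ncard_coe_finset]
    refine Nat.cast_le.2 (le_trans (Set.ncard_le_ncard ?_
      ((hχ (χ e)).1.image Subtype.val)) (Set.ncard_image_le (hχ (χ e)).1))
    intro f hf
    rw [mem_coe, mem_insert, mem_sameColour] at hf
    rcases hf with rfl | ⟨hd, -, hc⟩
    · exact ⟨e, rfl, rfl⟩
    · have hf : f ∈ (SimpleGraph.completeGraph (Fin n)).edgeSet := by
        induction f with | _ a b
        simpa using hd
      refine ⟨⟨f, hf⟩, ?_, rfl⟩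
      change χ ⟨f, hf⟩ = χ e
      rw [← hχ', ← hχ', hc]
  obtain ⟨m, hm⟩ : ∃ m, ⌊k⌋₊ = m + 1 := Nat.exists_eq_succ_of_ne_zero (by
    have := hcard e₀
    omega)
  have hkm : ((m + 1 : ℕ) : ℝ) ≤ k := by
    rw [← hm]
    refine Nat.floor_le (le_of_lt ?_)
    exact Nat.pos_of_floor_pos (by omega)
  have hm' : 51 * G.maxDegree ^ 2 * (m + 1) ≤ Fintype.card (Fin n) := by
    have hG' : (0 : ℝ) < G.maxDegree := by exact_mod_cast hG
    have h1 := (le_div_iff₀ (by positivity)).1 (hkm.trans hk)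
    rw [Fintype.card_fin]
    have h2 : ((51 * G.maxDegree ^ 2 * (m + 1) : ℕ) : ℝ) ≤ n := by
      push_cast at h1 ⊢
      linarith
    exact_mod_cast h2
  obtain ⟨φ, hφ⟩ := exists_rainbow_equiv (G := G) (χ := χ') hG G.degree_le_maxDegree
    (fun e he ↦ by
      have he' : e ∈ (SimpleGraph.completeGraph (Fin n)).edgeSet := by
        induction e with | _ a b
        simpa using he
      have : #(sameColour χ' e) + 1 ≤ ⌊k⌋₊ := hcard ⟨e, he'⟩
      omega) hn hm'
  let f : G →g SimpleGraph.completeGraph (Fin n) :=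
    ⟨φ, fun {a b} h ↦ by simpa using h.ne⟩
  refine ⟨⟨f, φ.injective⟩, fun a b hab ↦ Subtype.ext (hφ a a.2 b b.2 ?_)⟩
  have h1 := hχ' (f.mapEdgeSet a)
  have h2 := hχ' (f.mapEdgeSet b)
  exact h1.trans (Eq.trans hab h2.symm)

end RainbowCopy

theorem theorem7 :
    (∀ (n : ℕ) (V : Type*) [Fintype V] (G : SimpleGraph V) [DecidableRel G.Adj],
      Fintype.card V = n → 0 < G.maxDegree →
      ∀ k : ℝ, k ≤ (n : ℝ) / (51 * (G.maxDegree : ℝ) ^ 2) →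
      ∀ (C : Type*) (χ : (SimpleGraph.completeGraph (Fin n)).EdgeLabeling C),
        IsBoundedColouring χ k → HasRainbowCopy χ G) ∧
    (∀ D : ℕ, 0 < D → ∃ c : ℝ, 0 < c ∧
      ∀ (n : ℕ) (V : Type*) [Fintype V] (T : SimpleGraph V) [DecidableRel T.Adj],
        Fintype.card V = n → T.IsTree → T.maxDegree ≤ D →
        ∀ k : ℝ, k ≤ c * n →
        ∀ (C : Type*) (χ : (SimpleGraph.completeGraph (Fin n)).EdgeLabeling C),
          IsBoundedColouring χ k → HasRainbowCopy χ T) := by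
  refine ⟨fun n V _ G _ hV hG k hk C χ hχ ↦ RainbowCopy.hasRainbowCopy_of_le G hV hG hk χ hχ,
    fun D hD ↦ ⟨1 / (51 * (D : ℝ) ^ 2), by positivity, fun n V _ T _ hV _ hTD k hk C χ hχ ↦ ?_⟩⟩
  rcases Nat.eq_zero_or_pos T.maxDegree with h0 | h0
  · -- With maximum degree `0` there are no edges, and any bijection is a rainbow copy.
    have hT : ∀ a b, ¬T.Adj a b := fun a b h ↦ by
      have h1 := (T.degree_pos_iff_exists_adj a).2 ⟨b, h⟩
      have h2 := T.degree_le_maxDegree a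
      omega
    obtain ⟨φ⟩ := Fintype.card_eq.1 (hV.trans (Fintype.card_fin n).symm)
    refine ⟨⟨⟨φ, fun {a b} h ↦ (hT a b h).elim⟩, φ.injective⟩, fun e ↦ ?_⟩
    obtain ⟨e, he⟩ := e
    induction e with | _ a b
    exact (hT a b he).elim
  · refine RainbowCopy.hasRainbowCopy_of_le T hV h0 (hk.trans ?_) χ hχ
    have h1 : (0 : ℝ) < T.maxDegree := by exact_mod_cast h0
    have h2 : (T.maxDegree : ℝ) ≤ D := by exact_mod_cast hTD
    rw [div_mul_eq_mul_div, one_mul]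
    gcongr
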